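/- Call $\sum_{k\in\mathbb Z} c_k e^{ikt}$ a Fourier series if there is a complex-valued $f\in L_1([-\pi,\pi))$ such that $c_k=\frac1{2\pi}\int_{-\pi}^{\pi} f(t)e^{-ikt}\,dt$ for all $k\in\mathbb Z$. For a complex sequence $c=\{c_k\}_{k\in\mathbb Z}$, the discrete Hilbert transform is $$hc_n=\sum_{k=-\infty}^{\infty}\frac{c_k}{n+\frac12-k}:=\lim_{N\to\infty}\sum_{|k|\le N}\frac{c_k}{n+\frac12-k},\qquad n\in\mathbb Z,$$ whenever the limit exists. (i) If $\sum_{k\in\mathbb Z} c_k e^{ikt}$ is a Fourier series, then $hc_n$ exists for every $n\in\mathbb Z$, and $\lim_{|n|\to\infty}hc_n=0$. (ii) This condition contains Salem's conditions: if $c$ is any complex sequence for which $hc_n$ exists for every $n\in\mathbb Z$ and $hc_n\to0$ as $|n|\to\infty$, then for $a_n=c_n+c_{-n}$ and $b_n=i(c_n-c_{-n})$ the series below converge for every $k=0,1,2,\dots$ and $$\lim_{k\to\infty}k\sum_{n=1}^\infty\frac{a_n}{(k+\frac12)^2-n^2}=0,\qquad \lim_{k\to\infty}\sum_{n=1}^\infty\frac{n\,b_n}{(k+\frac12)^2-n^2}=0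 .$$ (iii) Consequently, if $a_n=\frac1\pi\int_{-\pi}^{\pi}f(t)\cos nt\,dt$ $(n\ge0)$ for some complex-valued $f\in L_1([-\pi,\pi))$, then the first series in (ii) converges for every $k=0,1,2,\dots$ and the first limit relation holds; and if $b_n=\frac1\pi\int_{-\pi}^{\pi}f(t)\sin nt\,dt$ $(n\ge1)$ for some such $f$, then the second series converges for every $k=0,1,2,\dots$ and the second limit relation holds. -/

import Mathlib

open Filter Topology
open scoped Real

noncomputable section

/-- `∑_{k ∈ ℤ} c k e^{ikt}` is a Fourier series: there is a complex-valued `f ∈ L¹(𝕋)`,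
`𝕋 = [-π, π)`, with `c k = (1 / 2π) ∫_𝕋 f t e^{-ikt} dt` for all `k ∈ ℤ`. -/
def IsFourierSeries (c : ℤ → ℂ) : Prop :=
  ∃ f : ℝ → ℂ, MeasureTheory.IntegrableOn f (Set.Ico (-π) π) ∧
    ∀ k : ℤ, c k = 1 / (2 * (π : ℂ)) *
      ∫ t in Set.Ico (-π) π, f t * Complex.exp (-(Complex.I * (k : ℂ) * (t : ℂ)))

/-- `a 0, a 1, …` are the cosine Fourier coefficients of an integrable function on `[-π, π)`. -/
def IsCosineFourierCoeff (a : ℕ → ℂ) : Prop :=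
  ∃ f : ℝ → ℂ, MeasureTheory.IntegrableOn f (Set.Ico (-π) π) ∧
    ∀ n : ℕ, a n = 1 / (π : ℂ) *
      ∫ t in Set.Ico (-π) π, f t * Complex.cos ((n : ℂ) * (t : ℂ))

/-- `b 1, b 2, …` are the sine Fourier coefficients of an integrable function on `[-π, π)`
(the value `b 0` is irrelevant). -/
def IsSineFourierCoeff (b : ℕ → ℂ) : Prop :=
  ∃ f : ℝ → ℂ, MeasureTheory.IntegrableOn f (Set.Ico (-π) π) ∧
    ∀ n : ℕ, 1 ≤ n → b n = 1 / (π : ℂ) *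
      ∫ t in Set.Ico (-π) π, f t * Complex.sin ((n : ℂ) * (t : ℂ))

/-- The two-sided series `∑_{k ∈ ℤ} c k / (n + 1/2 - k)` converges to `s`, as the limit of its
symmetric partial sums `∑_{|k| ≤ N}`. -/
def HasDiscreteHilbertAt (c : ℤ → ℂ) (n : ℤ) (s : ℂ) : Prop :=
  Tendsto (fun N : ℕ => ∑ k ∈ Finset.Icc (-(N : ℤ)) (N : ℤ), c k / ((n : ℂ) + 1 / 2 - (k : ℂ)))
    atTop (𝓝 s)

/-- The discrete Hilbert transform `hc` of `c` exists at every `n ∈ ℤ`, and `hc n → 0` as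
`|n| → ∞`. -/
def DiscreteHilbertVanishes (c : ℤ → ℂ) : Prop :=
  ∃ hc : ℤ → ℂ, (∀ n : ℤ, HasDiscreteHilbertAt c n (hc n)) ∧ Tendsto hc cofinite (𝓝 0)

/-- The series `∑_{n ≥ 1} a n / ((k + 1/2)² - n²)` converge for `k = 0, 1, …`, and `k` times the
sum tends to `0` as `k → ∞`. -/
def SalemCosineCondition (a : ℕ → ℂ) : Prop :=
  ∃ A : ℕ → ℂ,
    (∀ k : ℕ, Tendsto
      (fun N : ℕ => ∑ n ∈ Finset.Icc 1 N, a n / (((k : ℂ) + 1 / 2) ^ 2 - (n : ℂ) ^ 2))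
      atTop (𝓝 (A k))) ∧
    Tendsto (fun k : ℕ => (k : ℂ) * A k) atTop (𝓝 0)

/-- The series `∑_{n ≥ 1} n b n / ((k + 1/2)² - n²)` converge for `k = 0, 1, …`, and the
sum tends to `0` as `k → ∞`. -/
def SalemSineCondition (b : ℕ → ℂ) : Prop :=
  ∃ B : ℕ → ℂ,
    (∀ k : ℕ, Tendsto
      (fun N : ℕ => ∑ n ∈ Finset.Icc 1 N, (n : ℂ) * b n / (((k : ℂ) + 1 / 2) ^ 2 - (n : ℂ) ^ 2))
      atTop (𝓝 (B k))) ∧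
    Tendsto B atTop (𝓝 0)

end

/-! For the Fourier coefficients of `f`, the symmetric partial sum at `n = 0` is the integral of `f`
against an explicit kernel. Up to a vanishing term this kernel is `4i e^{-it/2}` times a square-wave
partial sum at `t/2` (`sum_exp_div_half_sub`). These sums converge to `(π/4) sgn t` and are
uniformly bounded (`exists_forall_abs_squareWaveSum_le`), so dominated convergence applies to every
integrable `f`. Modulating `f` by `e^{-int}` moves the index `0` to `n`, whence `hc n = (i/2) ∫ f(t)
sgn(t) e^{-i(n+1/2)t} dt`, which tends to `0` by Riemann–Lebesgue.

Salem's conditions follow by partial fractions: with `x = k + 1/2`, the poles `x` and `-x` of `1/(x²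
- n²)` belong to the indices `k` and `-k-1` of the transform. -/

/-! ### Convergence and uniform boundedness of the square-wave sums -/

/-- The partial sums `∑_{j < N} sin((2j+1)u)/(2j+1)` of the Fourier series of a square wave. -/
noncomputable def squareWaveSum (N : ℕ) (u : ℝ) : ℝ :=
  ∑ j ∈ Finset.range N, Real.sin ((2 * j + 1) * u) / (2 * j + 1)

lemma squareWaveSum_neg (N : ℕ) (u : ℝ) : squareWaveSum N (-u) = -squareWaveSum N u := by
  simp [squareWaveSum, neg_div]

lemma squareWaveSum_zero (N : ℕ) : squareWaveSum N 0 = 0 := by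
  simp [squareWaveSum]

lemma continuous_squareWaveSum (N : ℕ) : Continuous (squareWaveSum N) := by
  unfold squareWaveSum
  fun_prop

lemma hasDerivAt_squareWaveSum (N : ℕ) (u : ℝ) :
    HasDerivAt (squareWaveSum N) (∑ j ∈ Finset.range N, Real.cos ((2 * j + 1) * u)) u := by
  unfold squareWaveSum
  refine HasDerivAt.fun_sum fun j _ => ?_
  have hj : (2 * (j : ℝ) + 1) ≠ 0 := by positivity
  have h := ((hasDerivAt_id u).const_mul (2 * (j : ℝ) + 1)).sin.div_const (2 * (j : ℝ) + 1)
  convert! h using 1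
  simp only [id]
  field_simp

lemma two_mul_sin_mul_sum_cos (N : ℕ) (u : ℝ) :
    2 * Real.sin u * ∑ j ∈ Finset.range N, Real.cos ((2 * j + 1) * u) = Real.sin (2 * N * u) := by
  induction N with
  | zero => simp
  | succ N ih =>
    rw [Finset.sum_range_succ, mul_add, ih, Real.two_mul_sin_mul_cos]
    have h1 : u - (2 * N + 1) * u = -(2 * N * u) := by ring
    have h2 : u + (2 * N + 1) * u = 2 * (N + 1) * u := by ring
    rw [h1, h2, Real.sin_neg]
    push_cast
    ring

lemma squareWaveSum_pi_div_two (N : ℕ) :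
    squareWaveSum N (π / 2) = ∑ j ∈ Finset.range N, (-1 : ℝ) ^ j / (2 * j + 1) := by
  refine Finset.sum_congr rfl fun j _ => ?_
  have : (2 * (j : ℝ) + 1) * (π / 2) = π / 2 + j * π := by ring
  rw [this, Real.sin_add_nat_mul_pi, Real.sin_pi_div_two, mul_one]

/-- The derivative of the sum is `sin(2Nv) / (2 sin v)`. The correction added in `Q` cancels this
oscillation, and its `+ 1` keeps the numerator in `[0, 2]`, so `Q` is monotone. The signs `ε = ±1`
give the two halves of an absolute value bound. -/
lemma mul_squareWaveSum_pi_div_two_le {N : ℕ} (hN : 0 < N) {u : ℝ} (hu : 0 < u) (hu' : u ≤ π / 2)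
    {ε : ℝ} (hε : |ε| = 1) :
    ε * squareWaveSum N (π / 2) ≤ ε * squareWaveSum N u + 1 / (2 * N * Real.sin u) := by
  have hN' : (0 : ℝ) < N := by exact_mod_cast hN
  have hcos : ∀ x, |ε * Real.cos x| ≤ 1 := fun x => by
    rw [abs_mul, hε, one_mul]; exact Real.abs_cos_le_one x
  set Q : ℝ → ℝ := fun v => ε * squareWaveSum N v +
    (ε * Real.cos (2 * N * v) + 1) / (4 * N * Real.sin v) with hQ
  have hsin : ∀ v ∈ Set.Icc u (π / 2), 0 < Real.sin v := fun v hv =>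
    Real.sin_pos_of_pos_of_lt_pi (hu.trans_le hv.1) (by linarith [hv.2, Real.pi_pos])
  have hder : ∀ v ∈ Set.Icc u (π / 2), HasDerivAt Q
      (-((ε * Real.cos (2 * N * v) + 1) * Real.cos v / (4 * N * Real.sin v ^ 2))) v := by
    intro v hv
    have hs := (hsin v hv).ne'
    have h1 := (hasDerivAt_squareWaveSum N v).const_mul ε
    have h2 := (((((hasDerivAt_id v).const_mul (2 * (N : ℝ))).cos).const_mul ε).add_const 1).div
      ((Real.hasDerivAt_sin v).const_mul (4 * (N : ℝ))) (by positivity)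
    convert! h1.add h2 using 1
    have h3 : ∑ j ∈ Finset.range N, Real.cos ((2 * j + 1) * v) =
        Real.sin (2 * N * v) / (2 * Real.sin v) := by
      rw [← two_mul_sin_mul_sum_cos, mul_div_cancel_left₀ _ (by positivity)]
    rw [h3]
    simp only [id]
    field_simp
    ring
  have hanti : AntitoneOn Q (Set.Icc u (π / 2)) := by
    refine antitoneOn_of_deriv_nonpos (convex_Icc _ _)
      (fun v hv => (hder v hv).continuousAt.continuousWithinAt)
      (fun v hv => (hder v (interior_subset hv)).differentiableAt.differentiableWithinAt) ?_
    intro v hv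
    have hv := interior_subset hv
    rw [(hder v hv).deriv, neg_nonpos]
    have h1 : 0 ≤ Real.cos v := Real.cos_nonneg_of_mem_Icc ⟨by linarith [hv.1], hv.2⟩
    have h2 : 0 ≤ ε * Real.cos (2 * N * v) + 1 := by linarith [(abs_le.1 (hcos (2 * N * v))).1]
    positivity
  have h := hanti (Set.left_mem_Icc.2 hu') (Set.right_mem_Icc.2 hu') hu'
  simp only [hQ, Real.sin_pi_div_two] at h
  have h2 : 0 ≤ (ε * Real.cos (2 * N * (π / 2)) + 1) / (4 * N * 1) :=
    div_nonneg (by linarith [(abs_le.1 (hcos (2 * N * (π / 2)))).1]) (by positivity)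
  have hs := hsin u (Set.left_mem_Icc.2 hu')
  have h3 : (ε * Real.cos (2 * N * u) + 1) / (4 * N * Real.sin u) ≤ 1 / (2 * N * Real.sin u) := by
    rw [div_le_div_iff₀ (by positivity) (by positivity)]
    have := (abs_le.1 (hcos (2 * N * u))).2
    have h5 : 0 < 2 * N * Real.sin u := by positivity
    nlinarith
  linarith

lemma abs_squareWaveSum_sub_le {N : ℕ} (hN : 0 < N) {u : ℝ} (hu : 0 < u) (hu' : u ≤ π / 2) :
    |squareWaveSum N u - squareWaveSum N (π / 2)| ≤ 1 / (2 * N * Real.sin u) := by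
  have h1 := mul_squareWaveSum_pi_div_two_le hN hu hu' (ε := 1) (by simp)
  have h2 := mul_squareWaveSum_pi_div_two_le hN hu hu' (ε := -1) (by simp)
  rw [abs_le]
  constructor <;> linarith

lemma tendsto_squareWaveSum_of_pos {u : ℝ} (hu : 0 < u) (hu' : u ≤ π / 2) :
    Tendsto (fun N => squareWaveSum N u) atTop (𝓝 (π / 4)) := by
  have h1 : Tendsto (fun N => squareWaveSum N (π / 2)) atTop (𝓝 (π / 4)) := by
    -- At `π/2` the sum is Leibniz's series for `π/4`.
    simp_rw [squareWaveSum_pi_div_two]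
    exact Real.tendsto_sum_pi_div_four
  have h2 : Tendsto (fun N => squareWaveSum N u - squareWaveSum N (π / 2)) atTop (𝓝 0) := by
    refine squeeze_zero_norm' (a := fun N : ℕ => 1 / (2 * Real.sin u) * (1 / (N : ℝ))) ?_ ?_
    · filter_upwards [eventually_gt_atTop 0] with N hN
      refine (abs_squareWaveSum_sub_le hN hu hu').trans_eq ?_
      rw [one_div_mul_one_div]
      ring_nf
    · simpa using tendsto_one_div_atTop_nhds_zero_nat.const_mul (1 / (2 * Real.sin u))
  simpa using h2.add h1

lemma tendsto_squareWaveSum {u : ℝ} (hu : |u| ≤ π / 2) :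
    Tendsto (fun N => squareWaveSum N u) atTop (𝓝 (π / 4 * u.sign)) := by
  rcases lt_trichotomy u 0 with h | h | h
  · rw [Real.sign_of_neg h]
    have := (tendsto_squareWaveSum_of_pos (neg_pos.2 h) ((neg_le_abs u).trans hu)).neg
    simpa [squareWaveSum_neg] using this
  · simp [h, squareWaveSum_zero]
  · rw [Real.sign_of_pos h, mul_one]
    exact tendsto_squareWaveSum_of_pos h ((le_abs_self u).trans hu)

lemma abs_squareWaveSum_le (N : ℕ) (u : ℝ) : |squareWaveSum N u| ≤ N * |u| := by
  refine (Finset.abs_sum_le_sum_abs _ _).trans ?_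
  refine (Finset.sum_le_card_nsmul _ _ |u| fun j _ => ?_).trans (by simp)
  have hj : (0 : ℝ) < 2 * j + 1 := by positivity
  rw [abs_div, abs_of_pos hj, div_le_iff₀ hj]
  refine Real.abs_sin_le_abs.trans ?_
  rw [abs_mul, abs_of_pos hj, mul_comm]

/-- The trivial bound `N|u|` handles `N|u| ≤ 1`. Otherwise Jordan's inequality `sin u ≥ 2u/π` bounds
the distance to the convergent value at `π/2`. -/
lemma exists_forall_abs_squareWaveSum_le :
    ∃ C, ∀ (N : ℕ) (u : ℝ), |u| ≤ π / 2 → |squareWaveSum N u| ≤ C := by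
  have hconv : Tendsto (fun N => squareWaveSum N (π / 2)) atTop (𝓝 (π / 4)) :=
    tendsto_squareWaveSum_of_pos (by positivity) le_rfl
  obtain ⟨B, hB⟩ := hconv.norm.bddAbove_range
  have hB' : ∀ N, |squareWaveSum N (π / 2)| ≤ B := fun N => hB ⟨N, rfl⟩
  have hB0 : 0 ≤ B := (abs_nonneg _).trans (hB' 0)
  have hpos : ∀ (N : ℕ) (u : ℝ), 0 < u → u ≤ π / 2 → |squareWaveSum N u| ≤ B + π := by
    intro N u hu hu'
    rcases Nat.eq_zero_or_pos N with rfl | hN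
    · simp only [squareWaveSum, Finset.range_zero, Finset.sum_empty, abs_zero]
      positivity
    have hsin : 2 / π * u ≤ Real.sin u := Real.mul_le_sin hu.le hu'
    have hN' : (0 : ℝ) < N := by exact_mod_cast hN
    rcases le_total (N * u) 1 with h | h
    · refine (abs_squareWaveSum_le N u).trans ?_
      rw [abs_of_pos hu]
      linarith [Real.pi_gt_three]
    · have h1 := abs_squareWaveSum_sub_le hN hu hu'
      have h2 : 1 / (2 * N * Real.sin u) ≤ π := by
        rw [div_le_iff₀ (by have : 0 < Real.sin u := lt_of_lt_of_le (by positivity) hsin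
                            positivity)]
        have h3 : 2 * u ≤ π * Real.sin u := by
          have := mul_le_mul_of_nonneg_left hsin Real.pi_pos.le
          field_simp at this
          linarith
        have := mul_le_mul_of_nonneg_left h3 hN'.le
        nlinarith
      have h3 := abs_add_le (squareWaveSum N u - squareWaveSum N (π / 2))
        (squareWaveSum N (π / 2))
      rw [sub_add_cancel] at h3
      linarith [hB' N]
  refine ⟨B + π, fun N u hu => ?_⟩
  rcases lt_trichotomy u 0 with h | h | h
  · rw [← abs_neg, ← squareWaveSum_neg]
    exact hpos N _ (neg_pos.2 h) ((neg_le_abs u).trans hu)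
  · rw [h, squareWaveSum_zero, abs_zero]
    positivity
  · exact hpos N u h ((le_abs_self u).trans hu)

/-! ### The kernel at index zero, and shifts of the transform -/

lemma sum_Icc_neg_succ (g : ℤ → ℂ) (N : ℕ) :
    ∑ k ∈ Finset.Icc (-((N + 1 : ℕ) : ℤ)) ((N + 1 : ℕ) : ℤ), g k =
      ∑ k ∈ Finset.Icc (-(N : ℤ)) (N : ℤ), g k + (g (-((N : ℤ) + 1)) + g ((N : ℤ) + 1)) := by
  push_cast
  rw [Finset.Icc_succ_succ, Finset.sum_union (by simp), Finset.sum_pair (by lia)]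

/-- The denominators at `k = -j` and `k = j + 1` are opposite, so these terms pair into a sine; `k =
-N` is left unpaired. -/
lemma sum_exp_div_half_sub (N : ℕ) (t : ℝ) :
    ∑ k ∈ Finset.Icc (-(N : ℤ)) (N : ℤ),
        Complex.exp (-(Complex.I * (k : ℂ) * (t : ℂ))) / (1 / 2 - (k : ℂ)) =
      4 * Complex.I * Complex.exp (-(Complex.I * t / 2)) * squareWaveSum N (t / 2) +
        Complex.exp (Complex.I * N * t) / (1 / 2 + N) := by
  induction N with
  | zero => simp [squareWaveSum]
  | succ N ih =>
    rw [sum_Icc_neg_succ, ih]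
    have hs : squareWaveSum (N + 1) (t / 2) =
        squareWaveSum N (t / 2) + Real.sin ((2 * N + 1) * (t / 2)) / (2 * N + 1) :=
      Finset.sum_range_succ _ _
    have key : 4 * Complex.I * Complex.exp (-(Complex.I * t / 2)) *
        Complex.sin ((2 * N + 1) * (t / 2)) =
        2 * (Complex.exp (Complex.I * N * t) - Complex.exp (-(Complex.I * (N + 1) * t))) := by
      have h1 : Complex.exp (Complex.I * N * t) = Complex.exp (-(Complex.I * t / 2)) *
          Complex.exp ((2 * N + 1) * (t / 2) * Complex.I) := by
        rw [← Complex.exp_add]; congr 1; ring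
      have h2 : Complex.exp (-(Complex.I * (N + 1) * t)) = Complex.exp (-(Complex.I * t / 2)) *
          Complex.exp (-((2 * N + 1) * (t / 2)) * Complex.I) := by
        rw [← Complex.exp_add]; congr 1; ring
      rw [h1, h2, Complex.sin]
      linear_combination (2 * Complex.exp (-(Complex.I * t / 2)) *
        (Complex.exp (-((2 * N + 1) * (t / 2)) * Complex.I) -
        Complex.exp ((2 * N + 1) * (t / 2) * Complex.I))) * Complex.I_sq
    have e1 : (2 * N + 1 : ℂ) = 2 * (1 / 2 + N) := by ring
    have e2 : (1 / 2 - (N + 1) : ℂ) = -(1 / 2 + N) := by ring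
    have hx : 4 * Complex.I * Complex.exp (-(Complex.I * t / 2)) *
        (Complex.sin ((2 * N + 1) * (t / 2)) / (2 * N + 1)) =
        (Complex.exp (Complex.I * N * t) - Complex.exp (-(Complex.I * (N + 1) * t))) /
          (1 / 2 + N) := by
      rw [← mul_div_assoc, key, e1, mul_div_mul_left _ _ two_ne_zero]
    rw [hs]
    push_cast
    rw [mul_add (4 * Complex.I * Complex.exp (-(Complex.I * t / 2))), hx, e2, div_neg, sub_neg_eq_add,
      mul_neg, neg_mul, neg_neg]
    ring

/-- A shift of a bounded sequence by one shifts its discrete Hilbert transform by one. -/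
lemma hasDiscreteHilbertAt_shift_iff {c : ℤ → ℂ} {C : ℝ} (hC : ∀ k, ‖c k‖ ≤ C) (n : ℤ) (s : ℂ) :
    HasDiscreteHilbertAt (fun k => c (k + 1)) n s ↔ HasDiscreteHilbertAt c (n + 1) s := by
  -- Shifting the window gains the term at `N + 1` and loses the one at `-N`; both vanish in the
  -- limit since `c` is bounded.
  have hsum : ∀ N : ℕ, ∑ k ∈ Finset.Icc (-(N : ℤ)) (N : ℤ), c (k + 1) / ((n : ℂ) + 1 / 2 - k) =
      ∑ k ∈ Finset.Icc (-(N : ℤ)) (N : ℤ), c k / (((n + 1 : ℤ) : ℂ) + 1 / 2 - k) +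
        (c (N + 1) / ((n : ℂ) + 1 / 2 - N) - c (-N) / ((n : ℂ) + 1 + 1 / 2 + N)) := by
    intro N
    induction N with
    | zero =>
      simp
    | succ N ih =>
      rw [sum_Icc_neg_succ, sum_Icc_neg_succ, ih]
      have h1 : (-((N : ℤ) + 1) + 1) = -N := by ring
      rw [h1]
      push_cast
      have e2 : (n : ℂ) + 1 + 1 / 2 - (N + 1) = n + 1 / 2 - N := by ring
      have e4 : (n : ℂ) + 1 / 2 - -((N : ℂ) + 1) = n + 1 + 1 / 2 + N := by ring
      have e5 : (n : ℂ) + 1 + 1 / 2 - -((N : ℂ) + 1) = n + 1 + 1 / 2 + (N + 1) := by ring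
      simp only [e2, e4, e5]
      ring
  have hinv : ∀ x : ℂ, Tendsto (fun N : ℕ => ‖(x + N)⁻¹‖) atTop (𝓝 0) := fun x => by
    have h := tendsto_inv₀_cobounded.comp
      ((tendsto_const_add_cobounded x).comp (tendsto_natCast_atTop_cobounded (α := ℂ)))
    simpa using h.norm
  have hbdry : ∀ (x : ℂ) (d : ℕ → ℂ), (∀ N, ‖d N‖ ≤ C) →
      Tendsto (fun N : ℕ => d N / (x + N)) atTop (𝓝 0) := fun x d hd => by
    refine squeeze_zero_norm (fun N => ?_) (by simpa using (hinv x).const_mul C)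
    rw [div_eq_mul_inv, norm_mul, ← norm_inv]
    exact mul_le_mul_of_nonneg_right (hd N) (norm_nonneg _)
  have h0 : Tendsto (fun N : ℕ => c (N + 1) / ((n : ℂ) + 1 / 2 - N) -
      c (-N) / ((n : ℂ) + 1 + 1 / 2 + N)) atTop (𝓝 0) := by
    have h1 := hbdry (-((n : ℂ) + 1 / 2)) (fun N => -c (N + 1)) (fun N => by simpa using hC _)
    have h2 := hbdry ((n : ℂ) + 1 + 1 / 2) (fun N => c (-N)) (fun N => hC _)
    have h3 := h1.sub h2
    rw [sub_zero] at h3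
    refine h3.congr fun N => ?_
    rw [show -((n : ℂ) + 1 / 2) + N = -((n : ℂ) + 1 / 2 - N) by ring, neg_div_neg_eq]
  unfold HasDiscreteHilbertAt
  simp_rw [hsum]
  constructor
  · intro h
    simpa using h.sub h0
  · intro h
    simpa using h.add h0

lemma hasDiscreteHilbertAt_shift_int_iff {c : ℤ → ℂ} {C : ℝ} (hC : ∀ k, ‖c k‖ ≤ C) (d n : ℤ)
    (s : ℂ) : HasDiscreteHilbertAt (fun k => c (k + d)) n s ↔ HasDiscreteHilbertAt c (n + d) s := by
  induction d using Int.induction_on generalizing n with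
  | zero => simp
  | succ i ih =>
    rw [show n + ((i : ℤ) + 1) = n + 1 + i by ring, ← ih,
      ← hasDiscreteHilbertAt_shift_iff (c := fun k => c (k + i)) (fun k => hC _)]
    simp only [add_assoc, add_comm 1 (i : ℤ)]
  | pred i ih =>
    have h := hasDiscreteHilbertAt_shift_iff (c := fun k => c (k + (-(i : ℤ) - 1)))
      (fun k => hC _) (n - 1) s
    simp only [sub_add_cancel] at h
    rw [← h, show n + (-(i : ℤ) - 1) = n - 1 + -i by ring, ← ih]
    simp only [add_assoc, add_sub_cancel]

/-! ### The discrete Hilbert transform of Fourier coefficients -/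

/-- The `k`-th Fourier coefficient of `f` on `[-π, π)`. -/
noncomputable def expCoeff (f : ℝ → ℂ) (k : ℤ) : ℂ :=
  1 / (2 * (π : ℂ)) * ∫ t in Set.Ico (-π) π, f t * Complex.exp (-(Complex.I * (k : ℂ) * (t : ℂ)))

lemma norm_exp_neg_I_mul_mul (k : ℤ) (t : ℝ) :
    ‖Complex.exp (-(Complex.I * (k : ℂ) * (t : ℂ)))‖ = 1 := by
  rw [show -(Complex.I * (k : ℂ) * (t : ℂ)) = ((-(k * t) : ℝ) : ℂ) * Complex.I by
    push_cast; ring]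
  exact Complex.norm_exp_ofReal_mul_I _

lemma integrableOn_mul_exp_int {f : ℝ → ℂ} {s : Set ℝ} (hf : MeasureTheory.IntegrableOn f s)
    (k : ℤ) :
    MeasureTheory.IntegrableOn
      (fun t : ℝ => f t * Complex.exp (-(Complex.I * (k : ℂ) * (t : ℂ)))) s := by
  refine MeasureTheory.Integrable.mul_bdd (c := 1) hf ?_ ?_
  · exact Continuous.aestronglyMeasurable (by fun_prop)
  · exact Eventually.of_forall fun t => (norm_exp_neg_I_mul_mul k t).le

lemma exists_norm_expCoeff_le (f : ℝ → ℂ) : ∃ C, ∀ k, ‖expCoeff f k‖ ≤ C := by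
  refine ⟨‖1 / (2 * (π : ℂ))‖ * ∫ t in Set.Ico (-π) π, ‖f t‖, fun k => ?_⟩
  rw [expCoeff, norm_mul]
  refine mul_le_mul_of_nonneg_left ?_ (norm_nonneg _)
  refine (MeasureTheory.norm_integral_le_integral_norm _).trans_eq ?_
  refine MeasureTheory.integral_congr_ae (Eventually.of_forall fun t => ?_)
  simp only [norm_mul, norm_exp_neg_I_mul_mul, mul_one]

lemma expCoeff_add (f : ℝ → ℂ) (k n : ℤ) : expCoeff f (k + n) =
    expCoeff (fun t : ℝ => f t * Complex.exp (-(Complex.I * (n : ℂ) * (t : ℂ)))) k := by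
  unfold expCoeff
  congr 2
  ext t
  rw [mul_assoc (f t), ← Complex.exp_add]
  congr 2
  push_cast
  ring

/-- The discrete Hilbert transform at `0` of the Fourier coefficients of `f`. -/
lemma hasDiscreteHilbertAt_expCoeff_zero {f : ℝ → ℂ}
    (hf : MeasureTheory.IntegrableOn f (Set.Ico (-π) π)) :
    HasDiscreteHilbertAt (expCoeff f) 0
      (1 / (2 * (π : ℂ)) * ∫ t in Set.Ico (-π) π, f t *
        (4 * Complex.I * Complex.exp (-(Complex.I * t / 2)) *
          ((π / 4 * (t / 2).sign : ℝ) : ℂ))) := by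
  obtain ⟨C, hC⟩ := exists_forall_abs_squareWaveSum_le
  have hexp : ∀ t : ℝ, ‖Complex.exp (-(Complex.I * t / 2))‖ = 1 := fun t => by
    rw [show -(Complex.I * t / 2) = ((-(t / 2) : ℝ) : ℂ) * Complex.I by push_cast; ring]
    exact Complex.norm_exp_ofReal_mul_I _
  have hexp' : ∀ (N : ℕ) (t : ℝ), ‖Complex.exp (Complex.I * N * t)‖ = 1 := fun N t => by
    rw [show Complex.I * N * t = ((N * t : ℝ) : ℂ) * Complex.I by push_cast; ring]
    exact Complex.norm_exp_ofReal_mul_I _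
  have hd : ∀ N : ℕ, ‖(1 / 2 + N : ℂ)‖ = 1 / 2 + N := fun N => by
    rw [show (1 / 2 + N : ℂ) = ((1 / 2 + N : ℝ) : ℂ) by push_cast; ring, Complex.norm_real,
      Real.norm_of_nonneg (by positivity)]
  have hhalf : ∀ t ∈ Set.Ico (-π) π, |t / 2| ≤ π / 2 := fun t ht => by
    rw [abs_le]; constructor <;> linarith [ht.1, ht.2]
  set K : ℕ → ℝ → ℂ := fun N t =>
    4 * Complex.I * Complex.exp (-(Complex.I * t / 2)) * squareWaveSum N (t / 2) +
        Complex.exp (Complex.I * N * t) / (1 / 2 + N) with hK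
  have hKcont : ∀ N, Continuous (K N) := fun N => by
    have := continuous_squareWaveSum N
    simp only [hK]
    fun_prop
  have hsum : ∀ N : ℕ, ∑ k ∈ Finset.Icc (-(N : ℤ)) (N : ℤ),
      expCoeff f k / (((0 : ℤ) : ℂ) + 1 / 2 - (k : ℂ)) =
      1 / (2 * (π : ℂ)) * ∫ t in Set.Ico (-π) π, f t * K N t := by
    intro N
    simp only [hK, ← sum_exp_div_half_sub, Finset.mul_sum]
    simp only [expCoeff, mul_div_assoc, Int.cast_zero, zero_add]
    rw [MeasureTheory.integral_finsetSum, Finset.mul_sum]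
    · refine Finset.sum_congr rfl fun k _ => ?_
      simp_rw [← mul_div_assoc, MeasureTheory.integral_div, mul_div_assoc]
    · intro k _
      simp_rw [← mul_div_assoc]
      exact (integrableOn_mul_exp_int hf k).div_const _
  unfold HasDiscreteHilbertAt
  simp_rw [hsum]
  refine Tendsto.const_mul _ ?_
  -- `4 * C` bounds the square-wave part of the kernel, and `2` bounds `1 / (1/2 + N)`.
  refine MeasureTheory.tendsto_integral_of_dominated_convergence
    (fun t => ‖f t‖ * (4 * C + 2)) ?_ (hf.norm.mul_const _) ?_ ?_
  · exact fun N => hf.aestronglyMeasurable.mul (hKcont N).aestronglyMeasurable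
  · intro N
    filter_upwards [MeasureTheory.ae_restrict_mem measurableSet_Ico] with t ht
    rw [norm_mul]
    refine mul_le_mul_of_nonneg_left ?_ (norm_nonneg _)
    refine (norm_add_le _ _).trans (add_le_add ?_ ?_)
    · rw [norm_mul, norm_mul, norm_mul, hexp, Complex.norm_I, Complex.norm_real, Real.norm_eq_abs]
      have := hC N _ (hhalf t ht)
      norm_num
      exact this
    · rw [norm_div, hexp', hd, div_le_iff₀ (by positivity)]
      have : (0 : ℝ) ≤ N := by positivity
      linarith
  · filter_upwards [MeasureTheory.ae_restrict_mem measurableSet_Ico] with t ht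
    refine Tendsto.const_mul _ ?_
    have h1 := ((Complex.continuous_ofReal.tendsto _).comp
      (tendsto_squareWaveSum (hhalf t ht))).const_mul
        (4 * Complex.I * Complex.exp (-(Complex.I * t / 2)))
    have h2 : Tendsto (fun N : ℕ => Complex.exp (Complex.I * N * t) / (1 / 2 + N)) atTop (𝓝 0) := by
      refine squeeze_zero_norm (a := fun N : ℕ => ((1 / 2 : ℝ) + N)⁻¹) (fun N => ?_) ?_
      · rw [norm_div, hexp', hd, one_div]
      · exact (tendsto_atTop_add_const_left _ _ tendsto_natCast_atTop_atTop).inv_tendsto_atTop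
    simpa [hK] using h1.add h2

/-- Riemann–Lebesgue along the frequencies `(n + 1/2) / (2π)`. For non-integrable `g` every integral
takes the default value `0`. -/
lemma tendsto_integral_mul_exp_half_integer {g : ℝ → ℂ} :
    Tendsto (fun n : ℤ => ∫ t : ℝ, g t * Complex.exp (-(Complex.I * ((n : ℂ) + 1 / 2) * t)))
      cofinite (𝓝 0) := by
  have hcoe : Tendsto (fun n : ℤ => (2 * π)⁻¹ * ((n : ℝ) + 1 / 2)) cofinite (cocompact ℝ) :=
    ((Homeomorph.addRight (1 / 2 : ℝ)).trans
      (Homeomorph.mulLeft₀ (2 * π)⁻¹ (by positivity))).isClosedEmbedding.tendsto_cocompact.comp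
        Int.tendsto_coe_cofinite
  refine ((Real.tendsto_integral_exp_smul_cocompact g).comp hcoe).congr fun n => ?_
  refine MeasureTheory.integral_congr_ae (Eventually.of_forall fun t => ?_)
  simp only [Circle.smul_def, Real.fourierChar_apply, smul_eq_mul]
  rw [mul_comm]
  congr 2
  have : (π : ℂ) ≠ 0 := Complex.ofReal_ne_zero.2 Real.pi_ne_zero
  push_cast
  field_simp

theorem IsFourierSeries.discreteHilbertVanishes {c : ℤ → ℂ} (hc : IsFourierSeries c) :
    DiscreteHilbertVanishes c := by
  obtain ⟨f, hf, hcf⟩ := hc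
  obtain rfl : c = expCoeff f := funext hcf
  obtain ⟨C, hC⟩ := exists_norm_expCoeff_le f
  set g : ℝ → ℂ := (Set.Ico (-π) π).indicator
    (fun t => f t * ((t / 2).sign : ℂ)) with hg
  -- The factor `i/2` is `(1 / 2π) · 4i · (π / 4)`.
  refine ⟨fun n => Complex.I / 2 *
    ∫ t : ℝ, g t * Complex.exp (-(Complex.I * ((n : ℂ) + 1 / 2) * t)), fun n => ?_, ?_⟩
  · rw [← zero_add n, ← hasDiscreteHilbertAt_shift_int_iff hC, zero_add]
    simp_rw [expCoeff_add]
    have hfn : MeasureTheory.IntegrableOn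
        (fun t : ℝ => f t * Complex.exp (-(Complex.I * (n : ℂ) * (t : ℂ)))) (Set.Ico (-π) π) :=
      integrableOn_mul_exp_int hf n
    convert! hasDiscreteHilbertAt_expCoeff_zero hfn using 1
    have hgi : ∀ t : ℝ, g t * Complex.exp (-(Complex.I * ((n : ℂ) + 1 / 2) * t)) =
        (Set.Ico (-π) π).indicator (fun t : ℝ => f t * ((t / 2).sign : ℂ) *
          Complex.exp (-(Complex.I * ((n : ℂ) + 1 / 2) * t))) t := fun t => by
      by_cases ht : t ∈ Set.Ico (-π) π <;>
        simp only [hg, Set.indicator, ht, if_true, if_false, zero_mul]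
    simp_rw [hgi]
    rw [MeasureTheory.integral_indicator measurableSet_Ico, ← MeasureTheory.integral_const_mul,
      ← MeasureTheory.integral_const_mul]
    refine MeasureTheory.integral_congr_ae (Eventually.of_forall fun t => ?_)
    have hpi : (π : ℂ) ≠ 0 := Complex.ofReal_ne_zero.2 Real.pi_ne_zero
    have hexp : Complex.exp (-(Complex.I * ((n : ℂ) + 1 / 2) * t)) =
        Complex.exp (-(Complex.I * (n : ℂ) * (t : ℂ))) * Complex.exp (-(Complex.I * t / 2)) := by
      rw [← Complex.exp_add]; congr 1; ring
    simp only [hexp]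
    push_cast
    field_simp
  · simpa using tendsto_integral_mul_exp_half_integer.const_mul (Complex.I / 2)

/-! ### Reduction to Salem's conditions -/

lemma tendsto_natCast_cofinite_int : Tendsto (fun k : ℕ => (k : ℤ)) atTop cofinite := by
  rw [← Nat.cofinite_eq_atTop]
  exact Nat.cast_injective.tendsto_cofinite

lemma tendsto_neg_natCast_sub_one_cofinite_int :
    Tendsto (fun k : ℕ => -(k : ℤ) - 1) atTop cofinite := by
  rw [← Nat.cofinite_eq_atTop]
  exact Function.Injective.tendsto_cofinite fun a b h => by simpa using h

lemma natCast_add_half_sub_ne_zero (k : ℕ) (m : ℤ) : (k : ℂ) + 1 / 2 - m ≠ 0 := by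
  intro h
  have h1 : ((2 * k + 1 - 2 * m : ℤ) : ℂ) = 0 := by
    push_cast; linear_combination 2 * h
  have h2 : (2 * k + 1 - 2 * m : ℤ) = 0 := by exact_mod_cast h1
  omega

lemma natCast_add_half_add_ne_zero (k N : ℕ) : (k : ℂ) + 1 / 2 + (N + 1) ≠ 0 := by
  have := natCast_add_half_sub_ne_zero k (-(N + 1))
  push_cast at this
  rwa [sub_neg_eq_add] at this

/-- Partial fractions: `2x / (x² - n²) = 1/(x - n) + 1/(x + n)` with `x = k + 1/2`. The term `j = 0`
contributes `2 c 0 / x` to the difference of the two transforms and has to be removed. -/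
lemma sum_cosine_eq (c : ℤ → ℂ) (k N : ℕ) :
    ∑ n ∈ Finset.Icc 1 N, (c n + c (-n)) / (((k : ℂ) + 1 / 2) ^ 2 - (n : ℂ) ^ 2) =
      1 / (2 * ((k : ℂ) + 1 / 2)) *
      (∑ j ∈ Finset.Icc (-(N : ℤ)) N, c j / (((k : ℤ) : ℂ) + 1 / 2 - j) -
        ∑ j ∈ Finset.Icc (-(N : ℤ)) N, c j / (((-(k : ℤ) - 1 : ℤ) : ℂ) + 1 / 2 - j) -
        2 * c 0 / ((k : ℂ) + 1 / 2)) := by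
  have hx : (k : ℂ) + 1 / 2 ≠ 0 := by simpa using natCast_add_half_sub_ne_zero k 0
  induction N with
  | zero =>
    have e : -(k : ℂ) - 1 + 1 / 2 = -((k : ℂ) + 1 / 2) := by ring
    simp only [Nat.cast_zero, neg_zero, Finset.Icc_self, Finset.sum_singleton]
    push_cast
    simp only [e, sub_zero, div_neg]
    rw [Finset.Icc_eq_empty (by norm_num), Finset.sum_empty]
    ring
  | succ N ih =>
    rw [Finset.sum_Icc_succ_top (by omega), ih, sum_Icc_neg_succ, sum_Icc_neg_succ]
    have h1 : (k : ℂ) + 1 / 2 - (N + 1) ≠ 0 := by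
      simpa using natCast_add_half_sub_ne_zero k (N + 1)
    have h2 := natCast_add_half_add_ne_zero k N
    have e : -(k : ℂ) - 1 + 1 / 2 = -((k : ℂ) + 1 / 2) := by ring
    push_cast
    rw [e]
    generalize (k : ℂ) + 1 / 2 = x at *
    generalize (N : ℂ) + 1 = m at *
    have e1 : -x - m = -(x + m) := by ring
    have e2 : -x - -m = -(x - m) := by ring
    rw [e1, e2, sub_neg_eq_add, sq_sub_sq]
    field_simp
    ring

/-- Here `2n / (x² - n²) = 1/(x - n) - 1/(x + n)`, and the `j = 0` terms cancel. -/
lemma sum_sine_eq (c : ℤ → ℂ) (k N : ℕ) :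
    ∑ n ∈ Finset.Icc 1 N, (n : ℂ) * (Complex.I * (c n - c (-n))) /
        (((k : ℂ) + 1 / 2) ^ 2 - (n : ℂ) ^ 2) =
      Complex.I / 2 *
      (∑ j ∈ Finset.Icc (-(N : ℤ)) N, c j / (((k : ℤ) : ℂ) + 1 / 2 - j) +
        ∑ j ∈ Finset.Icc (-(N : ℤ)) N, c j / (((-(k : ℤ) - 1 : ℤ) : ℂ) + 1 / 2 - j)) := by
  have hx : (k : ℂ) + 1 / 2 ≠ 0 := by simpa using natCast_add_half_sub_ne_zero k 0
  induction N with
  | zero =>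
    have e : -(k : ℂ) - 1 + 1 / 2 = -((k : ℂ) + 1 / 2) := by ring
    simp only [Nat.cast_zero, neg_zero, Finset.Icc_self, Finset.sum_singleton]
    push_cast
    simp only [e, sub_zero, div_neg]
    rw [Finset.Icc_eq_empty (by norm_num), Finset.sum_empty]
    ring
  | succ N ih =>
    rw [Finset.sum_Icc_succ_top (by omega), ih, sum_Icc_neg_succ, sum_Icc_neg_succ]
    have h1 : (k : ℂ) + 1 / 2 - (N + 1) ≠ 0 := by
      simpa using natCast_add_half_sub_ne_zero k (N + 1)
    have h2 := natCast_add_half_add_ne_zero k N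
    have e : -(k : ℂ) - 1 + 1 / 2 = -((k : ℂ) + 1 / 2) := by ring
    push_cast
    rw [e]
    generalize (k : ℂ) + 1 / 2 = x at *
    generalize (N : ℂ) + 1 = m at *
    have e1 : -x - m = -(x + m) := by ring
    have e2 : -x - -m = -(x - m) := by ring
    rw [e1, e2, sub_neg_eq_add, sq_sub_sq]
    field_simp
    ring

theorem DiscreteHilbertVanishes.salemCosineCondition {c : ℤ → ℂ} (h : DiscreteHilbertVanishes c) :
    SalemCosineCondition (fun n : ℕ => c (n : ℤ) + c (-(n : ℤ))) := by
  obtain ⟨hc, hsum, hlim⟩ := h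
  refine ⟨fun k => 1 / (2 * ((k : ℂ) + 1 / 2)) *
    (hc k - hc (-k - 1) - 2 * c 0 / ((k : ℂ) + 1 / 2)), fun k => ?_, ?_⟩
  · simp_rw [sum_cosine_eq]
    exact (((hsum k).sub (hsum (-k - 1))).sub_const _).const_mul _
  · have hinv : Tendsto (fun k : ℕ => ((k : ℂ) + 1 / 2)⁻¹) atTop (𝓝 0) :=
      tendsto_inv₀_cobounded.comp
        ((tendsto_add_const_cobounded _).comp (tendsto_natCast_atTop_cobounded (α := ℂ)))
    have h1 := ((hlim.comp tendsto_natCast_cofinite_int).sub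
      (hlim.comp tendsto_neg_natCast_sub_one_cofinite_int)).sub (hinv.const_mul (2 * c 0))
    -- This is `k / (2x)` with `k = x - 1/2`, so the outer factor `k` is absorbed.
    have h2 : Tendsto (fun k : ℕ => 1 / 2 - 1 / 4 * ((k : ℂ) + 1 / 2)⁻¹) atTop
        (𝓝 (1 / 2 - 1 / 4 * 0)) := tendsto_const_nhds.sub (hinv.const_mul _)
    have h3 := h2.mul h1
    simp only [sub_zero, mul_zero] at h3
    refine h3.congr fun k => ?_
    have hx : (k : ℂ) + 1 / 2 ≠ 0 := by simpa using natCast_add_half_sub_ne_zero k 0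
    have h4 : 1 / 2 - 1 / 4 * ((k : ℂ) + 1 / 2)⁻¹ = k * (1 / (2 * ((k : ℂ) + 1 / 2))) := by
      have hk : (k : ℂ) = (k + 1 / 2) - 1 / 2 := by ring
      nth_rewrite 2 [hk]
      generalize (k : ℂ) + 1 / 2 = x at *
      field_simp
      ring
    simp only [h4, Function.comp_apply]
    rw [mul_assoc, ← div_eq_mul_inv (2 * c 0)]

theorem DiscreteHilbertVanishes.salemSineCondition {c : ℤ → ℂ} (h : DiscreteHilbertVanishes c) :
    SalemSineCondition (fun n : ℕ => Complex.I * (c (n : ℤ) - c (-(n : ℤ)))) := by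
  obtain ⟨hc, hsum, hlim⟩ := h
  refine ⟨fun k => Complex.I / 2 * (hc k + hc (-k - 1)), fun k => ?_, ?_⟩
  · simp_rw [sum_sine_eq]
    exact ((hsum k).add (hsum (-k - 1))).const_mul _
  · have h1 := (hlim.comp tendsto_natCast_cofinite_int).add
      (hlim.comp tendsto_neg_natCast_sub_one_cofinite_int)
    simpa using h1.const_mul (Complex.I / 2)

lemma isFourierSeries_expCoeff {f : ℝ → ℂ}
    (hf : MeasureTheory.IntegrableOn f (Set.Ico (-π) π)) : IsFourierSeries (expCoeff f) :=
  ⟨f, hf, fun _ => rfl⟩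

theorem IsCosineFourierCoeff.salemCosineCondition {a : ℕ → ℂ} (h : IsCosineFourierCoeff a) :
    SalemCosineCondition a := by
  obtain ⟨f, hf, ha⟩ := h
  have key : a = fun n : ℕ => expCoeff f n + expCoeff f (-n) := by
    ext n
    rw [ha, expCoeff, expCoeff, ← mul_add, ← MeasureTheory.integral_add,
      ← MeasureTheory.integral_const_mul, ← MeasureTheory.integral_const_mul]
    · congr 1
      ext t
      rw [Complex.cos]
      push_cast
      rw [show -(Complex.I * n * t) = -(n * t) * Complex.I by ring,
        show -(Complex.I * -n * t) = n * t * Complex.I by ring]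
      ring
    · exact integrableOn_mul_exp_int hf n
    · exact integrableOn_mul_exp_int hf (-n)
  rw [key]
  exact (isFourierSeries_expCoeff hf).discreteHilbertVanishes.salemCosineCondition

theorem IsSineFourierCoeff.salemSineCondition {b : ℕ → ℂ} (h : IsSineFourierCoeff b) :
    SalemSineCondition b := by
  obtain ⟨f, hf, hb⟩ := h
  have key : ∀ n : ℕ, 1 ≤ n → b n = Complex.I * (expCoeff f n - expCoeff f (-n)) := by
    intro n hn
    rw [hb n hn, expCoeff, expCoeff, ← mul_sub, ← MeasureTheory.integral_sub,
      ← MeasureTheory.integral_const_mul, ← MeasureTheory.integral_const_mul,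
      ← MeasureTheory.integral_const_mul]
    · congr 1
      ext t
      rw [Complex.sin]
      push_cast
      rw [show -(Complex.I * n * t) = -(n * t) * Complex.I by ring,
        show -(Complex.I * -n * t) = n * t * Complex.I by ring]
      ring
    · exact integrableOn_mul_exp_int hf n
    · exact integrableOn_mul_exp_int hf (-n)
  obtain ⟨B, hB, hlim⟩ := (isFourierSeries_expCoeff hf).discreteHilbertVanishes.salemSineCondition
  -- `b 0` is arbitrary, so the sums are compared termwise from `n = 1` rather than the sequences
  -- equated.
  refine ⟨B, fun k => (hB k).congr fun N => Finset.sum_congr rfl fun n hn => ?_, hlim⟩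
  rw [key n (Finset.mem_Icc.1 hn).1]

theorem mainTheorem5 :
    -- the discrete Hilbert transform of a Fourier series exists and vanishes at infinity
    (∀ c : ℤ → ℂ, IsFourierSeries c → DiscreteHilbertVanishes c) ∧
    -- in the real form of the series, this condition reduces to the two conditions of Salem
    (∀ c : ℤ → ℂ, DiscreteHilbertVanishes c →
      SalemCosineCondition (fun n : ℕ => c (n : ℤ) + c (-(n : ℤ))) ∧
      SalemSineCondition (fun n : ℕ => Complex.I * (c (n : ℤ) - c (-(n : ℤ))))) ∧
    -- hence the conditions of Salem are necessary
    (∀ a : ℕ → ℂ, IsCosineFourierCoeff a → SalemCosineCondition a) ∧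
    (∀ b : ℕ → ℂ, IsSineFourierCoeff b → SalemSineCondition b) :=
  ⟨fun _ h => h.discreteHilbertVanishes,
    fun _ h => ⟨h.salemCosineCondition, h.salemSineCondition⟩,
    fun _ h => h.salemCosineCondition, fun _ h => h.salemSineCondition⟩
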